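/- Let $q$ be a complex number with $|q|<1$. Write $(a;q)_n=\prod_{i=0}^{n-1}(1-aq^i)$ for integers $n\ge 0$, $(a;q)_\infty=\lim_{n\to\infty}(a;q)_n$, and $(a_1,a_2,a_3;q)_\infty=(a_1;q)_\infty(a_2;q)_\infty(a_3;q)_\infty$. Let $\nu$ be a positive integer, and for nonnegative integers $n_1,\dots,n_\nu$ put $N_k=n_k+n_{k+1}+\dots+n_\nu$ for $k=1,2,\dots,\nu$. Then the following series converges absolutely, and $$\sum_{n_1,n_2,\dots,n_\nu\ge 0}\frac{q^{3(N_1^2+N_2^2+\dots+N_\nu^2)}\,(-q;q^2)_{3n_\nu}}{(q^6;q^6)_{n_1}(q^6;q^6)_{n_2}\cdots(q^6;q^6)_{n_{\nu-1}}(q^6;q^6)_{2n_\nu}}=\frac{(-q^3;q^3)_\infty}{(q^{12};q^{12})_\infty}\,\bigl(q^{6(\nu+1)},-q^{3\nu+1},-q^{3\nu+5};q^{6(\nu+1)}\bigr)_\infty .$$ -/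

import Mathlib

/-- The finite `q`-Pochhammer symbol `(a;q)_n = (1 - a)(1 - a q) ⋯ (1 - a q^(n-1))`. -/
def qPoch (a q : ℂ) (n : ℕ) : ℂ :=
  ∏ i ∈ Finset.range n, (1 - a * q ^ i)

/-- The infinite `q`-Pochhammer symbol `(a;q)_∞ = lim_{n → ∞} (a;q)_n`. The limit exists whenever
`|q| < 1`, see `tendsto_qPoch`. -/
noncomputable def qPochInf (a q : ℂ) : ℂ :=
  Filter.limUnder Filter.atTop (fun n : ℕ => qPoch a q n)

/-- For `|q| < 1` the limit that defines `(a;q)_∞` exists. -/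
theorem tendsto_qPoch (a q : ℂ) (hq : ‖q‖ < 1) :
    Filter.Tendsto (fun n : ℕ => qPoch a q n) Filter.atTop (nhds (qPochInf a q)) := by
  have hs : Summable (fun i : ℕ => ‖-(a * q ^ i)‖) := by
    simp only [norm_neg, norm_mul, norm_pow]
    exact (summable_geometric_of_lt_one (norm_nonneg q) hq).mul_left _
  have h := (multipliable_one_add_of_summable hs).hasProd.tendsto_prod_nat
  simp only [← sub_eq_add_neg] at h
  exact tendsto_nhds_limUnder ⟨_, h⟩

/-- The tail sum `N_k = n_k + n_{k+1} + ⋯ + n_ν` of a tuple `n = (n_1, …, n_ν)`; the index `k`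
of the tuple is `k - 1` as an element of `Fin ν`. -/
def tailSum {ν : ℕ} (n : Fin ν → ℕ) (k : Fin ν) : ℕ :=
  ∑ j ∈ Finset.Ici k, n j

/-- The summand
`q^{3(N_1² + ⋯ + N_ν²)} (-q;q²)_{3 n_ν} /
  ((q⁶;q⁶)_{n_1} ⋯ (q⁶;q⁶)_{n_{ν-1}} (q⁶;q⁶)_{2 n_ν})`,
where `last` is the index of `n_ν`. -/
noncomputable def hierarchyTerm (q : ℂ) (ν : ℕ) (hν : 0 < ν) (n : Fin ν → ℕ) : ℂ :=
  let last : Fin ν := ⟨ν - 1, Nat.sub_lt hν Nat.one_pos⟩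
  q ^ (3 * ∑ k : Fin ν, tailSum n k ^ 2) * qPoch (-q) (q ^ 2) (3 * n last) /
    ((∏ j ∈ Finset.Iio last, qPoch (q ^ 6) (q ^ 6) (n j)) *
      qPoch (q ^ 6) (q ^ 6) (2 * n last))

/-! ### Finite identities: q-Chu–Vandermonde, the Bailey step, the finite triple product -/

section FiniteIdentities

open Finset

theorem qPoch_zero (a q : ℂ) : qPoch a q 0 = 1 := by simp [qPoch]

theorem qPoch_succ (a q : ℂ) (n : ℕ) : qPoch a q (n + 1) = qPoch a q n * (1 - a * q ^ n) := by
  simp [qPoch, prod_range_succ]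

theorem qPoch_add (a q : ℂ) (m n : ℕ) :
    qPoch a q (m + n) = qPoch a q m * qPoch (a * q ^ m) q n := by
  simp only [qPoch, prod_range_add]
  congr 1
  exact prod_congr rfl fun i _ => by ring

theorem qPoch_succ' (a q : ℂ) (n : ℕ) : qPoch a q (n + 1) = (1 - a) * qPoch (a * q) q n := by
  rw [add_comm, qPoch_add]
  simp [qPoch]

theorem qPoch_self_ne_zero {q : ℂ} (hq : ‖q‖ < 1) (n : ℕ) : qPoch q q n ≠ 0 := by
  refine prod_ne_zero_iff.2 fun i _ h => ?_
  have h1 : q ^ (i + 1) = 1 := by rw [pow_succ']; linear_combination -h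
  have h2 : ‖q‖ ^ (i + 1) < 1 := pow_lt_one₀ (norm_nonneg q) hq (Nat.succ_ne_zero i)
  rw [← norm_pow, h1, norm_one] at h2
  exact lt_irrefl _ h2

theorem sq_eq_two_mul_choose_two_add (i : ℕ) : i ^ 2 = 2 * i.choose 2 + i := by
  induction i with
  | zero => simp
  | succ i ih =>
    have : (i + 1).choose 2 = i + i.choose 2 := by
      rw [Nat.choose_succ_succ' i 1, Nat.choose_one_right]
    rw [this]; linarith [ih, add_sq i 1]

/-- The `q`-Chu–Vandermonde sum, cleared of the denominators `(A y; p)_i`. -/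
theorem qChuVandermonde {p : ℂ} (hp : ‖p‖ < 1) (A y : ℂ) (m : ℕ) :
    ∑ ij ∈ antidiagonal m, (-1) ^ ij.1 * p ^ ij.1.choose 2 * y ^ ij.1 * qPoch A p ij.1 *
      qPoch (A * y * p ^ ij.1) p ij.2 / (qPoch p p ij.1 * qPoch p p ij.2) =
    qPoch y p m / qPoch p p m := by
  have h0 := qPoch_self_ne_zero hp
  have hf : ∀ n, 1 - p * p ^ n ≠ 0 := fun n h => h0 (n + 1) (by rw [qPoch_succ, h, mul_zero])
  induction m generalizing y with
  | zero => simp [qPoch_zero]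
  | succ m ih =>
    set w : ℕ → ℕ → ℂ := fun i j => (-1) ^ i * p ^ i.choose 2 * y ^ i * qPoch A p i *
      qPoch (A * y * p ^ i) p j / (qPoch p p i * qPoch p p j) with hw
    change ∑ ij ∈ antidiagonal (m + 1), w ij.1 ij.2 = _
    -- For i + j = m + 1, 1 - p^(m+1) = p^i (1 - p^j) + (1 - p^i). Each part kills one end of the
    -- antidiagonal; after shifting, the two combine termwise into (1 - y) times the sum for m at y
    -- p.
    have split : (1 - p * p ^ m) * ∑ ij ∈ antidiagonal (m + 1), w ij.1 ij.2 =
        ∑ ij ∈ antidiagonal (m + 1), p ^ ij.1 * (1 - p ^ ij.2) * w ij.1 ij.2 +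
        ∑ ij ∈ antidiagonal (m + 1), (1 - p ^ ij.1) * w ij.1 ij.2 := by
      rw [mul_sum, ← sum_add_distrib]
      refine sum_congr rfl fun ij h => ?_
      have : p * p ^ m = p ^ ij.1 * p ^ ij.2 := by
        rw [← pow_add, mem_antidiagonal.1 h, pow_succ']
      rw [this]; ring
    rw [Nat.sum_antidiagonal_succ' (f := fun ij => p ^ ij.1 * (1 - p ^ ij.2) * w ij.1 ij.2),
      Nat.sum_antidiagonal_succ (f := fun ij => (1 - p ^ ij.1) * w ij.1 ij.2)] at split
    simp only [pow_zero, sub_self, mul_zero, zero_mul, zero_add] at split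
    rw [← sum_add_distrib] at split
    have step : ∀ ij ∈ antidiagonal m,
        p ^ ij.1 * (1 - p ^ (ij.2 + 1)) * w ij.1 (ij.2 + 1) +
          (1 - p ^ (ij.1 + 1)) * w (ij.1 + 1) ij.2 =
        (1 - y) * ((-1) ^ ij.1 * p ^ ij.1.choose 2 * (y * p) ^ ij.1 * qPoch A p ij.1 *
          qPoch (A * (y * p) * p ^ ij.1) p ij.2 / (qPoch p p ij.1 * qPoch p p ij.2)) := by
      rintro ⟨i, j⟩ -
      have hc : (i + 1).choose 2 = i + i.choose 2 := by
        rw [Nat.choose_succ_succ' i 1, Nat.choose_one_right]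
      simp only [hw, hc]
      rw [qPoch_succ' (A * y * p ^ i), qPoch_succ A, qPoch_succ p p i, qPoch_succ p p j,
        show A * y * p ^ (i + 1) = A * (y * p) * p ^ i by ring,
        show A * y * p ^ i * p = A * (y * p) * p ^ i by ring]
      have hi := hf i
      have hj := hf j
      have := h0 i
      have := h0 j
      rw [pow_succ' p j, pow_succ' p i, pow_add p, pow_succ (-1 : ℂ), pow_succ y, mul_pow y p]
      generalize qPoch (A * (y * p) * p ^ i) p j = Z
      generalize 1 - p * p ^ i = u at hi ⊢
      generalize 1 - p * p ^ j = v at hj ⊢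
      field_simp
      ring
    rw [sum_congr rfl step, ← mul_sum, ih (y * p)] at split
    rw [qPoch_succ', qPoch_succ p p m, eq_div_iff (mul_ne_zero (h0 m) (hf m))]
    have := h0 m
    generalize qPoch (y * p) p m = Z at split ⊢
    field_simp at split
    linear_combination split

/-- The reciprocal `1 / (p; p)_n`, understood as `0` for negative `n`. -/
noncomputable def qPochRecip (p : ℂ) (n : ℤ) : ℂ :=
  if 0 ≤ n then (qPoch p p n.toNat)⁻¹ else 0

theorem qPochRecip_natCast (p : ℂ) (n : ℕ) : qPochRecip p n = (qPoch p p n)⁻¹ := by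
  simp [qPochRecip]

theorem qPochRecip_of_neg (p : ℂ) {n : ℤ} (h : n < 0) : qPochRecip p n = 0 := by
  simp [qPochRecip, h]

/-- The conjugate Bailey pair identity behind the iteration `α_j ↦ s ^ (j ^ 2) α_j`. -/
theorem sum_qPochRecip_bailey {s : ℂ} (hs : ‖s ^ 2‖ < 1) (L : ℕ) (j : ℤ) :
    ∑ r ∈ range (L + 1), s ^ r ^ 2 * qPoch (-s) (s ^ 2) r * qPochRecip (s ^ 2) (L - r : ℤ) *
      (qPochRecip (s ^ 2) (r - j) * qPochRecip (s ^ 2) (r + j)) =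
    s ^ j.natAbs ^ 2 * qPoch (-s) (s ^ 2) L *
      (qPochRecip (s ^ 2) (L - j) * qPochRecip (s ^ 2) (L + j)) := by
  set p := s ^ 2 with hp
  have h0 := qPoch_self_ne_zero hs
  -- The kernel is even in j, so j may be replaced by d = |j|.
  have symm : ∀ r : ℤ, qPochRecip p (r - j) * qPochRecip p (r + j) =
      qPochRecip p (r - j.natAbs) * qPochRecip p (r + j.natAbs) := by
    intro r
    rcases Int.natAbs_eq j with h | h
    · rw [← h]
    · generalize j.natAbs = d at h
      subst h
      rw [sub_neg_eq_add, ← sub_eq_add_neg, mul_comm]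
  simp only [symm]
  generalize j.natAbs = d
  by_cases hd : d ≤ L
  swap
  · rw [qPochRecip_of_neg p (by omega : (L : ℤ) - d < 0)]
    rw [zero_mul, mul_zero]
    refine sum_eq_zero fun r hr => ?_
    rw [mem_range] at hr
    rw [qPochRecip_of_neg p (by omega : (r : ℤ) - d < 0), zero_mul, mul_zero]
  obtain ⟨m, rfl⟩ := Nat.exists_eq_add_of_le hd
  rw [add_assoc, sum_range_add]
  rw [sum_eq_zero, zero_add]
  swap
  · intro r hr
    rw [mem_range] at hr
    rw [qPochRecip_of_neg p (by omega : (r : ℤ) - d < 0), zero_mul, mul_zero]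
  -- Only r = d + i contributes. With A = y = -s p^d, A y p^i = p^(2d+i+1), so (A y p^i; p)_k is the
  -- tail completing (p;p)_{2d+i} to (p;p)_{2d+m}.
  have key := qChuVandermonde hs (-(s * p ^ d)) (-(s * p ^ d)) m
  rw [Nat.sum_antidiagonal_eq_sum_range_succ_mk] at key
  have e1 : ((d + m : ℕ) : ℤ) - d = m := by push_cast; ring
  have e2 : ((d + m : ℕ) : ℤ) + d = (2 * d + m : ℕ) := by push_cast; ring
  rw [e1, e2, qPochRecip_natCast, qPochRecip_natCast, qPoch_add (-s) p d m]
  have : s ^ d ^ 2 * (qPoch (-s) p d * qPoch (-s * p ^ d) p m) *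
      ((qPoch p p m)⁻¹ * (qPoch p p (2 * d + m))⁻¹) =
      s ^ d ^ 2 * qPoch (-s) p d * (qPoch p p (2 * d + m))⁻¹ *
        (qPoch (-(s * p ^ d)) p m / qPoch p p m) := by
    rw [neg_mul]; ring
  rw [this, ← key, mul_sum]
  refine sum_congr rfl fun i hi => ?_
  rw [mem_range, Nat.lt_succ_iff] at hi
  obtain ⟨k, rfl⟩ := Nat.exists_eq_add_of_le hi
  have e3 : ((d + (i + k) : ℕ) : ℤ) - (d + i : ℕ) = k := by push_cast; ring
  have e4 : ((d + i : ℕ) : ℤ) - d = i := by push_cast; ring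
  have e5 : ((d + i : ℕ) : ℤ) + d = (2 * d + i : ℕ) := by push_cast; ring
  rw [e3, e4, e5]
  simp only [qPochRecip_natCast, Nat.add_sub_cancel_left]
  have e6 : qPoch p p (2 * d + (i + k)) = qPoch p p (2 * d + i) *
      qPoch (-(s * p ^ d) * -(s * p ^ d) * p ^ i) p k := by
    rw [← add_assoc, qPoch_add p p (2 * d + i)]
    congr 2
    rw [hp]; ring
  have h2 := h0 (2 * d + (i + k))
  rw [e6] at h2 ⊢
  have h3 := left_ne_zero_of_mul h2
  have h4 := right_ne_zero_of_mul h2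
  have hi0 := h0 i
  have hk0 := h0 k
  rw [qPoch_add (-s) p d i, neg_mul s]
  have e7 : s ^ (d + i) ^ 2 = s ^ d ^ 2 * ((-1) ^ i * p ^ i.choose 2 * (-(s * p ^ d)) ^ i) := by
    rw [neg_pow (s * p ^ d), show ∀ a b c : ℂ, a * b * (a * c) = (a * a) * (b * c) by intros; ring,
      ← mul_pow, neg_one_mul, neg_neg, one_pow, one_mul, mul_pow, hp, ← pow_mul, ← pow_mul,
      ← pow_mul, ← pow_add, ← pow_add, ← pow_add]
    congr 1
    have := sq_eq_two_mul_choose_two_add i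
    linear_combination this
  rw [e7]
  generalize qPoch (-(s * p ^ d) * -(s * p ^ d) * p ^ i) p k = Z at h4 ⊢
  field_simp

/-- The `q`-binomial theorem. -/
theorem qBinomial {p : ℂ} (hp : ‖p‖ < 1) (y : ℂ) (m : ℕ) :
    ∑ i ∈ range (m + 1), (-1) ^ i * p ^ i.choose 2 * y ^ i /
      (qPoch p p i * qPoch p p (m - i)) = qPoch y p m / qPoch p p m := by
  have h := qChuVandermonde hp 0 y m
  have h1 : ∀ n, qPoch 0 p n = 1 := fun n => by simp [qPoch]
  rw [Nat.sum_antidiagonal_eq_sum_range_succ_mk] at h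
  simpa [h1] using h

/-- The finite form of the Jacobi triple product. -/
theorem finite_jacobi_triple_product {s z : ℂ} (hs : ‖s ^ 2‖ < 1) (hs0 : s ≠ 0) (hz : z ≠ 0)
    (n : ℕ) :
    ∑ j ∈ Icc (-n : ℤ) n, s ^ j.natAbs ^ 2 * z ^ j *
      (qPochRecip (s ^ 2) (n - j) * qPochRecip (s ^ 2) (n + j)) =
    qPoch (-(z * s)) (s ^ 2) n * qPoch (-(s / z)) (s ^ 2) n / qPoch (s ^ 2) (s ^ 2) (2 * n) := by
  -- This y centres the product: its last n factors are (-zs;s²)_n, and its first n, reversed, give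
  -- (-s/z;s²)_n up to a monomial. The summation index is i = j + n.
  have key := qBinomial hs (-(z * s ^ (1 - 2 * n : ℤ))) (2 * n)
  have prodeq : qPoch (-(z * s ^ (1 - 2 * n : ℤ))) (s ^ 2) (2 * n) =
      z ^ n * (s ^ n ^ 2)⁻¹ * (qPoch (-(z * s)) (s ^ 2) n * qPoch (-(s / z)) (s ^ 2) n) := by
    rw [two_mul n, qPoch_add]
    have h1 : -(z * s ^ (1 - 2 * n : ℤ)) * (s ^ 2) ^ n = -(z * s) := by
      rw [← pow_mul, ← zpow_natCast, neg_mul, mul_assoc, ← zpow_add₀ hs0]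
      push_cast
      simp
    rw [h1, mul_comm (qPoch (-(z * s)) _ _), ← mul_assoc]
    congr 1
    have h2 : qPoch (-(z * s ^ (1 - 2 * n : ℤ))) (s ^ 2) n =
        ∏ i ∈ range n, (z * (s ^ (2 * i + 1))⁻¹ * (1 - -(s / z) * (s ^ 2) ^ i)) := by
      rw [qPoch, ← prod_range_reflect]
      refine prod_congr rfl fun i hi => ?_
      rw [mem_range] at hi
      have h3 : s ^ (1 - 2 * n : ℤ) * (s ^ 2) ^ (n - 1 - i) = (s ^ (2 * i + 1))⁻¹ := by
        rw [← pow_mul, ← zpow_natCast, ← zpow_natCast, ← zpow_add₀ hs0, ← zpow_neg]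
        congr 1
        omega
      rw [neg_mul, mul_assoc, h3]
      field_simp
      ring
    have h4 : ∑ i ∈ range n, (2 * i + 1) = n ^ 2 := by
      clear * -
      induction n with
      | zero => rfl
      | succ n ih => rw [sum_range_succ, ih]; ring
    rw [h2, prod_mul_distrib, prod_mul_distrib, prod_const, card_range, prod_inv_distrib,
      prod_pow_eq_pow_sum, h4]
    rfl
  have hc : z ^ n * (s ^ n ^ 2)⁻¹ ≠ 0 := by positivity
  rw [prodeq, mul_div_assoc] at key
  apply mul_left_cancel₀ hc
  rw [← key, mul_sum]
  symm
  refine sum_nbij' (fun i => (i : ℤ) - n) (fun j => (j + n).toNat) ?_ ?_ ?_ ?_ ?_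
  · intro i hi
    simp only [mem_range, mem_Icc] at hi ⊢
    omega
  · intro j hj
    simp only [mem_range, mem_Icc] at hj ⊢
    omega
  · intro i _
    simp
  · intro j hj
    simp only [mem_Icc] at hj
    omega
  · intro i hi
    simp only [mem_range] at hi
    have e1 : (n : ℤ) - ((i : ℤ) - n) = (2 * n - i : ℕ) := by omega
    have e2 : (n : ℤ) + ((i : ℤ) - n) = i := by ring
    rw [e1, e2, qPochRecip_natCast, qPochRecip_natCast]
    have e3 : (-1) ^ i * (s ^ 2) ^ i.choose 2 * (-(z * s ^ (1 - 2 * n : ℤ))) ^ i =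
        z ^ n * (s ^ n ^ 2)⁻¹ * (s ^ ((i : ℤ) - n).natAbs ^ 2 * z ^ ((i : ℤ) - n)) := by
      rw [neg_pow (z * _),
        show ∀ a b c : ℂ, a * b * (a * c) = (a * a) * (b * c) by intros; ring,
        ← mul_pow, neg_one_mul, neg_neg, one_pow, one_mul, mul_pow, ← pow_mul, zpow_sub₀ hz,
        zpow_natCast, zpow_natCast]
      have e4 : s ^ (2 * i.choose 2) * (s ^ (1 - 2 * n : ℤ)) ^ i =
          (s ^ n ^ 2)⁻¹ * s ^ ((i : ℤ) - n).natAbs ^ 2 := by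
        rw [← zpow_natCast s (2 * i.choose 2), ← zpow_natCast s (n ^ 2),
          ← zpow_natCast s (((i : ℤ) - n).natAbs ^ 2), ← zpow_natCast (s ^ (1 - 2 * n : ℤ)) i,
          ← zpow_mul, ← zpow_neg, ← zpow_add₀ hs0, ← zpow_add₀ hs0]
        congr 1
        have := sq_eq_two_mul_choose_two_add i
        zify at this
        push_cast
        rw [sq_abs]
        linear_combination -this
      have hzn : z ^ n ≠ 0 := pow_ne_zero _ hz
      rw [mul_left_comm, e4]
      field_simp
    rw [e3]
    field_simp

end FiniteIdentities

/-! ### Limits: the infinite triple product and the Bailey chain -/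

section Limits

open Finset Filter Topology

theorem norm_pow_lt_one {q : ℂ} (hq : ‖q‖ < 1) {k : ℕ} (hk : k ≠ 0) : ‖q ^ k‖ < 1 := by
  rw [norm_pow]; exact pow_lt_one₀ (norm_nonneg q) hq hk

theorem exists_norm_le_of_tendsto {u : ℕ → ℂ} {x : ℂ} (h : Tendsto u atTop (𝓝 x)) :
    ∃ C, ∀ n, ‖u n‖ ≤ C := by
  obtain ⟨C, hC⟩ := (Metric.isBounded_range_of_tendsto u h).exists_norm_le
  exact ⟨C, fun n => hC _ ⟨n, rfl⟩⟩

theorem qPochInf_self_ne_zero {p : ℂ} (hp : ‖p‖ < 1) : qPochInf p p ≠ 0 := by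
  have hs : Summable (fun i : ℕ => ‖-(p * p ^ i)‖) := by
    simp only [norm_neg, norm_mul, norm_pow]
    exact (summable_geometric_of_lt_one (norm_nonneg p) hp).mul_left _
  have h := (multipliable_one_add_of_summable hs).hasProd.tendsto_prod_nat
  have h1 : ∀ i : ℕ, 1 + -(p * p ^ i) ≠ 0 := fun i hi =>
    qPoch_self_ne_zero hp (i + 1) (by rw [qPoch_succ, sub_eq_add_neg, hi, mul_zero])
  have h2 := tprod_one_add_ne_zero_of_summable h1 hs
  simp only [← sub_eq_add_neg] at h h2
  rwa [tendsto_nhds_unique (tendsto_qPoch p p hp) h]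

theorem tendsto_qPochRecip {p : ℂ} (hp : ‖p‖ < 1) :
    Tendsto (qPochRecip p) atTop (𝓝 (qPochInf p p)⁻¹) := by
  have h := ((tendsto_qPoch p p hp).inv₀ (qPochInf_self_ne_zero hp)).comp
    (tendsto_atTop.2 fun b => (eventually_ge_atTop (b : ℤ)).mono fun n hn =>
      (by omega : b ≤ n.toNat))
  refine h.congr' ?_
  filter_upwards [eventually_ge_atTop 0] with n hn
  simp [qPochRecip, hn]

theorem exists_norm_qPochRecip_le {p : ℂ} (hp : ‖p‖ < 1) :
    ∃ C, 0 ≤ C ∧ ∀ n, ‖qPochRecip p n‖ ≤ C := by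
  obtain ⟨C, hC⟩ := exists_norm_le_of_tendsto
    ((tendsto_qPoch p p hp).inv₀ (qPochInf_self_ne_zero hp))
  have hC0 : 0 ≤ C := (norm_nonneg _).trans (hC 0)
  refine ⟨C, hC0, fun n => ?_⟩
  unfold qPochRecip
  split_ifs
  · exact hC _
  · simpa using hC0

/-- The reciprocals vanish for |j| > r, so the sum is a full series over the integers, and their
uniform bound permits dominated convergence. -/
theorem tendsto_sum_qPochRecip {p : ℂ} (hp : ‖p‖ < 1) {c : ℤ → ℂ} (hc : Summable fun j => ‖c j‖) :
    Tendsto (fun r : ℕ => ∑ j ∈ Icc (-r : ℤ) r, c j * (qPochRecip p (r - j) * qPochRecip p (r + j)))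
      atTop (𝓝 ((∑' j, c j) * ((qPochInf p p)⁻¹ * (qPochInf p p)⁻¹))) := by
  obtain ⟨C, hC0, hC⟩ := exists_norm_qPochRecip_le hp
  have h : ∀ r : ℕ, ∑ j ∈ Icc (-r : ℤ) r, c j * (qPochRecip p (r - j) * qPochRecip p (r + j)) =
      ∑' j, c j * (qPochRecip p (r - j) * qPochRecip p (r + j)) := by
    intro r
    refine (tsum_eq_sum fun j hj => ?_).symm
    rw [mem_Icc, not_and_or, not_le, not_le] at hj
    rcases hj with hj | hj
    · rw [qPochRecip_of_neg p (by omega : (r : ℤ) + j < 0), mul_zero, mul_zero]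
    · rw [qPochRecip_of_neg p (by omega : (r : ℤ) - j < 0), zero_mul, mul_zero]
  simp only [h]
  rw [← tsum_mul_right]
  refine tendsto_tsum_of_dominated_convergence (hc.mul_right (C * C)) (fun j => ?_)
    (Eventually.of_forall fun r j => ?_)
  · refine Tendsto.const_mul _ (Tendsto.mul ?_ ?_)
    · exact (tendsto_qPochRecip hp).comp
        (tendsto_atTop_add_const_right _ (-j) tendsto_natCast_atTop_atTop)
    · exact (tendsto_qPochRecip hp).comp
        (tendsto_atTop_add_const_right _ j tendsto_natCast_atTop_atTop)
  · rw [norm_mul, norm_mul]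
    gcongr <;> exact hC _

theorem summable_pow_sq_mul_pow {s z : ℂ} (hs : ‖s‖ < 1) (hs0 : s ≠ 0) (hz : z ≠ 0) :
    Summable fun n : ℕ => s ^ n ^ 2 * z ^ n := by
  refine summable_of_ratio_test_tendsto_lt_one (l := 0) one_pos
    (Eventually.of_forall fun n => by positivity) ?_
  have h : Tendsto (fun n : ℕ => ‖s‖ * ‖z‖ * (‖s‖ ^ 2) ^ n) atTop (𝓝 (‖s‖ * ‖z‖ * 0)) :=
    (tendsto_pow_atTop_nhds_zero_of_lt_one (by positivity)
      (pow_lt_one₀ (norm_nonneg s) hs two_ne_zero)).const_mul _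
  rw [mul_zero] at h
  refine h.congr fun n => ?_
  have h1 : ‖s‖ ≠ 0 := norm_ne_zero_iff.2 hs0
  have h2 : ‖z‖ ≠ 0 := norm_ne_zero_iff.2 hz
  simp only [norm_mul, norm_pow]
  rw [eq_div_iff (by positivity)]
  ring

theorem summable_norm_jacobi {s z : ℂ} (hs : ‖s‖ < 1) (hs0 : s ≠ 0) (hz : z ≠ 0) :
    Summable fun j : ℤ => ‖s ^ j.natAbs ^ 2 * z ^ j‖ := by
  apply Summable.of_nat_of_neg
  · simpa using (summable_pow_sq_mul_pow hs hs0 hz).norm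
  · simpa using (summable_pow_sq_mul_pow hs hs0 (inv_ne_zero hz)).norm

/-- The Jacobi triple product identity. -/
theorem jacobi_triple_product {s z : ℂ} (hs : ‖s‖ < 1) (hs0 : s ≠ 0) (hz : z ≠ 0) :
    ∑' j : ℤ, s ^ j.natAbs ^ 2 * z ^ j =
      qPochInf (s ^ 2) (s ^ 2) * qPochInf (-(z * s)) (s ^ 2) * qPochInf (-(s / z)) (s ^ 2) := by
  have hp := norm_pow_lt_one hs two_ne_zero
  have hP := qPochInf_self_ne_zero hp
  have h1 := tendsto_sum_qPochRecip hp (summable_norm_jacobi hs hs0 hz)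
  simp only [finite_jacobi_triple_product hp hs0 hz] at h1
  have h2 := ((tendsto_qPoch (-(z * s)) _ hp).mul (tendsto_qPoch (-(s / z)) _ hp)).div
    ((tendsto_qPoch (s ^ 2) _ hp).comp (tendsto_id.const_mul_atTop' two_pos)) hP
  have h3 := tendsto_nhds_unique h1 h2
  field_simp at h3
  rw [h3]
  ring_nf

/-- The rescaled member `(-s; s ^ 2)_r β_r` of the `m`-th iterated Bailey pair with
`α_j = c j * s ^ (m * j ^ 2)`. -/
noncomputable def baileyBeta (s : ℂ) (c : ℤ → ℂ) (m r : ℕ) : ℂ :=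
  qPoch (-s) (s ^ 2) r * ∑ j ∈ Icc (-r : ℤ) r, c j * s ^ (m * j.natAbs ^ 2) *
    (qPochRecip (s ^ 2) (r - j) * qPochRecip (s ^ 2) (r + j))

/-- One step of the chain: after exchanging the sums, `sum_qPochRecip_bailey` acts on each j
separately. -/
theorem sum_baileyBeta {s : ℂ} (hs : ‖s ^ 2‖ < 1) (c : ℤ → ℂ) (m L : ℕ) :
    ∑ r ∈ range (L + 1), s ^ r ^ 2 * baileyBeta s c m r * qPochRecip (s ^ 2) (L - r : ℤ) =
      baileyBeta s c (m + 1) L := by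
  have h : ∀ r ∈ range (L + 1), s ^ r ^ 2 * baileyBeta s c m r * qPochRecip (s ^ 2) (L - r : ℤ) =
      ∑ j ∈ Icc (-L : ℤ) L, c j * s ^ (m * j.natAbs ^ 2) *
        (s ^ r ^ 2 * qPoch (-s) (s ^ 2) r * qPochRecip (s ^ 2) (L - r : ℤ) *
          (qPochRecip (s ^ 2) (r - j) * qPochRecip (s ^ 2) (r + j))) := by
    intro r hr
    rw [mem_range, Nat.lt_succ_iff] at hr
    rw [← sum_subset (Icc_subset_Icc (by omega) (by omega) : Icc (-r : ℤ) r ⊆ Icc (-L : ℤ) L)]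
    · rw [baileyBeta, mul_sum, mul_sum, sum_mul]
      exact sum_congr rfl fun j _ => by ring
    · intro j _ hj
      rw [mem_Icc, not_and_or, not_le, not_le] at hj
      rcases hj with hj | hj
      · rw [qPochRecip_of_neg _ (by omega : (r : ℤ) + j < 0)]; simp
      · rw [qPochRecip_of_neg _ (by omega : (r : ℤ) - j < 0)]; simp
  rw [sum_congr rfl h, sum_comm, baileyBeta, mul_sum]
  refine sum_congr rfl fun j _ => ?_
  rw [← mul_sum, sum_qPochRecip_bailey hs, add_mul, one_mul, pow_add]
  ring

theorem tendsto_baileyBeta {s : ℂ} (hs : ‖s‖ < 1) {c : ℤ → ℂ} (hc : Summable fun j => ‖c j‖)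
    (m : ℕ) :
    Tendsto (baileyBeta s c m) atTop (𝓝 (qPochInf (-s) (s ^ 2) *
      ((∑' j : ℤ, c j * s ^ (m * j.natAbs ^ 2)) *
        ((qPochInf (s ^ 2) (s ^ 2))⁻¹ * (qPochInf (s ^ 2) (s ^ 2))⁻¹)))) := by
  have hp := norm_pow_lt_one hs two_ne_zero
  refine (tendsto_qPoch (-s) _ hp).mul (tendsto_sum_qPochRecip hp ?_)
  refine Summable.of_nonneg_of_le (fun _ => norm_nonneg _) (fun j => ?_) hc
  rw [norm_mul, norm_pow]
  exact mul_le_of_le_one_right (norm_nonneg _) (pow_le_one₀ (norm_nonneg _) hs.le)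

theorem norm_pow_sq_le {s : ℂ} (hs : ‖s‖ < 1) {a n : ℕ} (h : a ≤ n) : ‖s ^ n ^ 2‖ ≤ ‖s‖ ^ a := by
  rw [norm_pow]
  exact pow_le_pow_of_le_one (norm_nonneg _) hs.le (h.trans (Nat.le_self_pow two_ne_zero n))

/-- Let L → ∞ in `sum_baileyBeta`, by dominated convergence on the left and `tendsto_baileyBeta` on
the right; one factor 1/(p;p)_∞ cancels. -/
theorem tsum_baileyBeta {s : ℂ} (hs : ‖s‖ < 1) {c : ℤ → ℂ} (hc : Summable fun j => ‖c j‖)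
    (m : ℕ) :
    ∑' r : ℕ, s ^ r ^ 2 * baileyBeta s c m r =
      qPochInf (-s) (s ^ 2) / qPochInf (s ^ 2) (s ^ 2) *
        ∑' j : ℤ, c j * s ^ ((m + 1) * j.natAbs ^ 2) := by
  have hp := norm_pow_lt_one hs two_ne_zero
  have hP := qPochInf_self_ne_zero hp
  obtain ⟨C, hC0, hC⟩ := exists_norm_qPochRecip_le hp
  obtain ⟨B, hB⟩ := exists_norm_le_of_tendsto (tendsto_baileyBeta hs hc m)
  have hB0 : 0 ≤ B := (norm_nonneg _).trans (hB 0)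
  have h1 : Tendsto (fun L : ℕ => ∑' r : ℕ,
      s ^ r ^ 2 * baileyBeta s c m r * qPochRecip (s ^ 2) (L - r : ℤ)) atTop
      (𝓝 (∑' r : ℕ, s ^ r ^ 2 * baileyBeta s c m r * (qPochInf (s ^ 2) (s ^ 2))⁻¹)) := by
    refine tendsto_tsum_of_dominated_convergence (bound := fun r => ‖s‖ ^ r * B * C)
      (((summable_geometric_of_lt_one (norm_nonneg s) hs).mul_right _).mul_right _)
      (fun r => ?_) (Eventually.of_forall fun L r => ?_)
    · exact ((tendsto_qPochRecip hp).comp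
        (tendsto_atTop_add_const_right _ (-(r : ℤ)) tendsto_natCast_atTop_atTop)).const_mul _
    · rw [norm_mul, norm_mul]
      gcongr
      · exact norm_pow_sq_le hs le_rfl
      · exact hB r
      · exact hC _
  have h2 : ∀ L : ℕ, ∑' r : ℕ, s ^ r ^ 2 * baileyBeta s c m r * qPochRecip (s ^ 2) (L - r : ℤ) =
      baileyBeta s c (m + 1) L := by
    intro L
    rw [← sum_baileyBeta hp]
    refine tsum_eq_sum fun r hr => ?_
    rw [mem_range] at hr
    rw [qPochRecip_of_neg _ (by omega : (L : ℤ) - r < 0), mul_zero]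
  simp only [h2] at h1
  have h3 := tendsto_nhds_unique h1 (tendsto_baileyBeta hs hc (m + 1))
  rw [tsum_mul_right] at h3
  field_simp at h3 ⊢
  linear_combination h3

end Limits

/-! ### The multiple sum as an iterated Bailey chain -/

section MultipleSums

open Finset

/-- The odd exponents are split by residue 1, 3, 5 modulo 6. -/
theorem qPoch_three_mul (q : ℂ) (r : ℕ) :
    qPoch (-q) (q ^ 2) (3 * r) =
      qPoch (-q ^ 3) (q ^ 6) r * (qPoch (-q ^ 5) (q ^ 6) r * qPoch (-q) (q ^ 6) r) := by
  induction r with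
  | zero => simp [qPoch_zero]
  | succ r ih =>
    rw [show 3 * (r + 1) = 3 * r + 1 + 1 + 1 by ring]
    simp only [qPoch_succ, ih]
    ring

theorem baileyBeta_zero {q : ℂ} (hq : ‖q‖ < 1) (hq0 : q ≠ 0) (r : ℕ) :
    baileyBeta (q ^ 3) (fun j => (q ^ 3) ^ j.natAbs ^ 2 * (q ^ 2) ^ j) 0 r =
      qPoch (-q) (q ^ 2) (3 * r) / qPoch (q ^ 6) (q ^ 6) (2 * r) := by
  have h6 : (q ^ 3) ^ 2 = q ^ 6 := by ring
  have hp : ‖(q ^ 3) ^ 2‖ < 1 := h6 ▸ norm_pow_lt_one hq (by norm_num)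
  have h := finite_jacobi_triple_product hp (pow_ne_zero 3 hq0) (pow_ne_zero 2 hq0) r
  simp only [baileyBeta, zero_mul, pow_zero, mul_one]
  have e1 : -(q ^ 2 * q ^ 3) = -q ^ 5 := by ring
  have e2 : -(q ^ 3 / q ^ 2) = -q := by
    rw [pow_succ q 2, mul_div_cancel_left₀ _ (pow_ne_zero 2 hq0)]
  rw [h, h6, e1, e2, qPoch_three_mul]
  ring

theorem tailSum_zero {m : ℕ} (n : Fin (m + 1) → ℕ) : tailSum n 0 = ∑ j, n j := by
  simp only [tailSum, ← bot_eq_zero, Ici_bot]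

theorem tailSum_cons_succ {m : ℕ} (a : ℕ) (n : Fin m → ℕ) (k : Fin m) :
    tailSum (Fin.cons a n : Fin (m + 1) → ℕ) k.succ = tailSum n k := by
  simp only [tailSum]
  rw [← Fin.map_succEmb_Ici, sum_map]
  simp

theorem hierarchyTerm_one (q : ℂ) (h : 0 < 1) (n : Fin 1 → ℕ) :
    hierarchyTerm q 1 h n = (q ^ 3) ^ n 0 ^ 2 *
      (qPoch (-q) (q ^ 2) (3 * n 0) / qPoch (q ^ 6) (q ^ 6) (2 * n 0)) := by
  have h1 : (⟨1 - 1, Nat.sub_lt h Nat.one_pos⟩ : Fin 1) = 0 := rfl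
  have h2 : Iio (0 : Fin 1) = ∅ := rfl
  simp only [hierarchyTerm, h1, h2, prod_empty, Fin.sum_univ_one, one_mul]
  rw [tailSum_zero, Fin.sum_univ_one, pow_mul, mul_div_assoc]

theorem hierarchyTerm_cons (q : ℂ) (m : ℕ) (h : 0 < m + 2) (h' : 0 < m + 1) (a : ℕ)
    (n : Fin (m + 1) → ℕ) :
    hierarchyTerm q (m + 2) h (Fin.cons a n) =
      (q ^ 3) ^ (a + ∑ j, n j) ^ 2 * qPochRecip (q ^ 6) a * hierarchyTerm q (m + 1) h' n := by
  have h1 : (⟨m + 2 - 1, Nat.sub_lt h Nat.one_pos⟩ : Fin (m + 2)) = (Fin.last m).succ := rfl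
  have h2 : (⟨m + 1 - 1, Nat.sub_lt h' Nat.one_pos⟩ : Fin (m + 1)) = Fin.last m := rfl
  simp only [hierarchyTerm, h1, h2, Fin.cons_succ]
  rw [Fin.succ_last, Fin.Iio_last_eq_map, Fin.Iio_last_eq_map, prod_map, prod_map,
    Fin.sum_univ_succ, Fin.prod_univ_succ, tailSum_zero, Fin.sum_univ_succ (Fin.cons a n),
    qPochRecip_natCast]
  simp only [tailSum_cons_succ, Fin.cons_zero, Fin.cons_succ, Fin.castSuccEmb_apply,
    Fin.castSucc_zero, Fin.castSucc_succ]
  rw [mul_add, pow_add, pow_mul q 3]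
  simp only [div_eq_mul_inv, mul_inv]
  ring

theorem summable_norm_hierarchyTerm {q : ℂ} (hq : ‖q‖ < 1) (m : ℕ) (h : 0 < m + 1) :
    Summable fun n : Fin (m + 1) → ℕ => ‖hierarchyTerm q (m + 1) h n‖ := by
  have h3 : ‖q ^ 3‖ < 1 := norm_pow_lt_one hq (by norm_num)
  have h6 : ‖q ^ 6‖ < 1 := norm_pow_lt_one hq (by norm_num)
  obtain ⟨C, hC0, hC⟩ := exists_norm_qPochRecip_le h6
  have hg := summable_geometric_of_lt_one (norm_nonneg (q ^ 3)) h3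
  induction m with
  | zero =>
    obtain ⟨B, hB⟩ := exists_norm_le_of_tendsto
      (tendsto_qPoch (-q) (q ^ 2) (norm_pow_lt_one hq two_ne_zero))
    rw [← (Equiv.funUnique (Fin 1) ℕ).symm.summable_iff]
    refine Summable.of_nonneg_of_le (fun _ => norm_nonneg _) (fun r => ?_) (hg.mul_right (B * C))
    have hB0 : 0 ≤ B := (norm_nonneg _).trans (hB 0)
    change ‖hierarchyTerm q 1 h fun _ => r‖ ≤ _
    rw [hierarchyTerm_one, norm_mul, div_eq_mul_inv, ← qPochRecip_natCast, norm_mul]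
    gcongr
    · exact norm_pow_sq_le h3 le_rfl
    · exact hB _
    · exact hC _
  | succ m ih =>
    rw [← (Fin.consEquiv fun _ => ℕ).summable_iff]
    refine Summable.of_nonneg_of_le (fun _ => norm_nonneg _) (fun an => ?_)
      ((hg.mul_right C).mul_of_nonneg (ih m.succ_pos) (fun _ => by positivity)
        (fun _ => norm_nonneg _))
    obtain ⟨a, n⟩ := an
    change ‖hierarchyTerm q (m + 2) h (Fin.cons a n)‖ ≤ _
    rw [hierarchyTerm_cons q m h m.succ_pos, norm_mul, norm_mul]
    gcongr
    · exact norm_pow_sq_le h3 (Nat.le_add_right _ _)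
    · exact hC _

/-- The weight g(N_1) makes the induction close: summing out n_1 leaves a shorter sum whose weight
is a bounded function of N_2. -/
theorem tsum_hierarchyTerm_mul {q : ℂ} (hq : ‖q‖ < 1) {c : ℤ → ℂ} (hc : Summable fun j => ‖c j‖)
    (h0 : ∀ r, baileyBeta (q ^ 3) c 0 r =
      qPoch (-q) (q ^ 2) (3 * r) / qPoch (q ^ 6) (q ^ 6) (2 * r))
    (m : ℕ) (h : 0 < m + 1) (g : ℕ → ℂ) {D : ℝ} (hg : ∀ r, ‖g r‖ ≤ D) :
    ∑' n : Fin (m + 1) → ℕ, hierarchyTerm q (m + 1) h n * g (∑ j, n j) =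
      ∑' r : ℕ, (q ^ 3) ^ r ^ 2 * baileyBeta (q ^ 3) c m r * g r := by
  have h3 : ‖q ^ 3‖ < 1 := norm_pow_lt_one hq (by norm_num)
  have h6 : ‖q ^ 6‖ < 1 := norm_pow_lt_one hq (by norm_num)
  have h36 : (q ^ 3) ^ 2 = q ^ 6 := by ring
  obtain ⟨C, hC0, hC⟩ := exists_norm_qPochRecip_le h6
  have hgeo := summable_geometric_of_lt_one (norm_nonneg (q ^ 3)) h3
  have hD0 : 0 ≤ D := (norm_nonneg _).trans (hg 0)
  induction m generalizing g D with
  | zero =>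
    rw [← (Equiv.funUnique (Fin 1) ℕ).symm.tsum_eq]
    refine tsum_congr fun r => ?_
    change hierarchyTerm q 1 h (fun _ => r) * g (∑ _j : Fin 1, r) = _
    rw [hierarchyTerm_one, h0, Fin.sum_univ_one]
  | succ m ih =>
    set w : ℕ → ℕ → ℂ := fun a M => (q ^ 3) ^ (a + M) ^ 2 * qPochRecip (q ^ 6) a * g (a + M) with hw
    have hwle : ∀ a M, ‖w a M‖ ≤ ‖q ^ 3‖ ^ a * C * D := by
      intro a M
      rw [hw, norm_mul, norm_mul]
      gcongr
      · exact norm_pow_sq_le h3 (Nat.le_add_right _ _)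
      · exact hC _
      · exact hg _
    have hwsum : Summable fun a => ‖q ^ 3‖ ^ a * C * D := (hgeo.mul_right _).mul_right _
    have hG : ∀ M, ‖∑' a, w a M‖ ≤ ∑' a, ‖q ^ 3‖ ^ a * C * D := fun M =>
      tsum_of_norm_bounded hwsum.hasSum fun a => hwle a M
    obtain ⟨B, hB⟩ := exists_norm_le_of_tendsto (tendsto_baileyBeta h3 hc m)
    have hB0 : 0 ≤ B := (norm_nonneg _).trans (hB 0)
    have s1 : Summable fun na : (Fin (m + 1) → ℕ) × ℕ =>
        hierarchyTerm q (m + 1) m.succ_pos na.1 * w na.2 (∑ j, na.1 j) := by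
      refine Summable.of_norm_bounded ((summable_norm_hierarchyTerm hq m m.succ_pos).mul_of_nonneg
        hwsum (fun _ => norm_nonneg _) (fun _ => by positivity)) fun na => ?_
      rw [norm_mul]
      gcongr
      exact hwle _ _
    have s2 : Summable fun ra : ℕ × ℕ =>
        (q ^ 3) ^ ra.1 ^ 2 * baileyBeta (q ^ 3) c m ra.1 * w ra.2 ra.1 := by
      refine Summable.of_norm_bounded ((hgeo.mul_right B).mul_of_nonneg
        hwsum (fun _ => by positivity) (fun _ => by positivity)) fun ra => ?_
      rw [norm_mul, norm_mul]
      gcongr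
      · exact norm_pow_sq_le h3 le_rfl
      · exact hB _
      · exact hwle _ _
    calc ∑' n : Fin (m + 2) → ℕ, hierarchyTerm q (m + 2) h n * g (∑ j, n j)
        = ∑' na : (Fin (m + 1) → ℕ) × ℕ,
            hierarchyTerm q (m + 1) m.succ_pos na.1 * w na.2 (∑ j, na.1 j) := by
          rw [← ((Equiv.prodComm _ _).trans (Fin.consEquiv fun _ => ℕ)).tsum_eq]
          refine tsum_congr fun ⟨n, a⟩ => ?_
          change hierarchyTerm q (m + 2) h (Fin.cons a n) *
            g (∑ j, (Fin.cons a n : Fin (m + 2) → ℕ) j) = _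
          rw [hierarchyTerm_cons q m h m.succ_pos,
            Fin.sum_univ_succ (Fin.cons a n : Fin (m + 2) → ℕ)]
          simp only [Fin.cons_zero, Fin.cons_succ, hw]
          ring
      _ = ∑' n : Fin (m + 1) → ℕ,
            hierarchyTerm q (m + 1) m.succ_pos n * ∑' a, w a (∑ j, n j) := by
          rw [s1.tsum_prod]
          simp only [tsum_mul_left]
      _ = ∑' r : ℕ, (q ^ 3) ^ r ^ 2 * baileyBeta (q ^ 3) c m r * ∑' a, w a r :=
          ih m.succ_pos (fun M => ∑' a, w a M) hG (tsum_nonneg fun _ => by positivity)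
      _ = ∑' ra : ℕ × ℕ, (q ^ 3) ^ ra.1 ^ 2 * baileyBeta (q ^ 3) c m ra.1 * w ra.2 ra.1 := by
          rw [s2.tsum_prod]
          simp only [tsum_mul_left]
      _ = ∑' L : ℕ, (q ^ 3) ^ L ^ 2 * baileyBeta (q ^ 3) c (m + 1) L * g L := by
          -- Grouping by L = r + a, that is N_1 = N_2 + n_1, makes the inner sum finite and equal to
          -- one Bailey step.
          refine ((HasAntidiagonal.sigmaAntidiagonalEquivProd (A := ℕ)).tsum_eq _).symm.trans
            ((Summable.tsum_sigma ((HasAntidiagonal.sigmaAntidiagonalEquivProd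
              (A := ℕ)).summable_iff.2 s2)).trans (tsum_congr fun L => ?_))
          simp only [Function.comp_apply, HasAntidiagonal.sigmaAntidiagonalEquivProd_apply]
          rw [tsum_fintype, sum_coe_sort (antidiagonal L) fun ra : ℕ × ℕ =>
              (q ^ 3) ^ ra.1 ^ 2 * baileyBeta (q ^ 3) c m ra.1 * w ra.2 ra.1,
            Nat.sum_antidiagonal_eq_sum_range_succ_mk,
            ← sum_baileyBeta (by rwa [h36]), mul_sum, sum_mul]
          refine sum_congr rfl fun r hr => ?_
          rw [mem_range, Nat.lt_succ_iff] at hr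
          simp only [hw, Nat.sub_add_cancel hr, Nat.cast_sub hr, h36]
          ring

/-! ### Infinite products in the prefactor, and the case q = 0 -/

theorem qPochInf_eq_of_eventually_eq {a q x : ℂ} (h : ∀ n, 0 < n → qPoch a q n = x) :
    qPochInf a q = x :=
  (tendsto_const_nhds.congr' (Filter.eventually_gt_atTop 0 |>.mono fun n hn => (h n hn).symm)
    ).limUnder_eq

theorem qPochInf_zero_left (q : ℂ) : qPochInf 0 q = 1 :=
  qPochInf_eq_of_eventually_eq fun n _ => by simp [qPoch]

theorem qPochInf_neg_mul_neg {s : ℂ} (hs : ‖s‖ < 1) :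
    qPochInf (-s) (s ^ 2) * qPochInf (-s ^ 2) (s ^ 2) = qPochInf (-s) s := by
  have hp := norm_pow_lt_one hs two_ne_zero
  have h1 := (tendsto_qPoch (-s) _ hp).mul (tendsto_qPoch (-s ^ 2) _ hp)
  have h2 := (tendsto_qPoch (-s) s hs).comp (Filter.tendsto_id.const_mul_atTop' two_pos)
  refine tendsto_nhds_unique h1 (h2.congr fun n => ?_)
  simp only [Function.comp_apply, id]
  induction n with
  | zero => simp [qPoch_zero]
  | succ n ih =>
    rw [show 2 * (n + 1) = 2 * n + 1 + 1 by ring]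
    simp only [qPoch_succ, ih]
    ring

theorem qPochInf_self_mul_neg {p : ℂ} (hp : ‖p‖ < 1) :
    qPochInf p p * qPochInf (-p) p = qPochInf (p ^ 2) (p ^ 2) := by
  refine tendsto_nhds_unique ((tendsto_qPoch p p hp).mul (tendsto_qPoch (-p) p hp))
    ((tendsto_qPoch _ _ (norm_pow_lt_one hp two_ne_zero)).congr fun n => ?_)
  rw [qPoch, qPoch, qPoch, ← prod_mul_distrib]
  exact prod_congr rfl fun i _ => by ring

/-- Numerator and denominator on the right are those on the left, each times (-q⁶;q⁶)_∞. -/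
theorem qPochInf_prefactor {q : ℂ} (hq : ‖q‖ < 1) :
    qPochInf (-q ^ 3) (q ^ 6) / qPochInf (q ^ 6) (q ^ 6) =
      qPochInf (-q ^ 3) (q ^ 3) / qPochInf (q ^ 12) (q ^ 12) := by
  have h6 : ‖q ^ 6‖ < 1 := norm_pow_lt_one hq (by norm_num)
  have h12 : ‖q ^ 12‖ < 1 := norm_pow_lt_one hq (by norm_num)
  have e1 := qPochInf_neg_mul_neg (norm_pow_lt_one hq (k := 3) (by norm_num))
  have e2 := qPochInf_self_mul_neg h6
  rw [← pow_mul] at e1 e2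
  rw [div_eq_div_iff (qPochInf_self_ne_zero h6) (qPochInf_self_ne_zero h12), ← e1, ← e2]
  ring

theorem hierarchyTerm_base_zero (ν : ℕ) (hν : 0 < ν) (n : Fin ν → ℕ) :
    hierarchyTerm 0 ν hν n = if n = 0 then 1 else 0 := by
  split_ifs with h
  · subst h
    simp [hierarchyTerm, tailSum, qPoch]
  · obtain ⟨k, hk⟩ := Function.ne_iff.1 h
    have h1 : tailSum n k ≠ 0 := fun h0 => hk (sum_eq_zero_iff.1 h0 k (mem_Ici.2 le_rfl))
    have h2 : ∑ k : Fin ν, tailSum n k ^ 2 ≠ 0 := fun h0 =>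
      pow_ne_zero 2 h1 (sum_eq_zero_iff.1 h0 k (mem_univ k))
    simp [hierarchyTerm, h2]

end MultipleSums

theorem theorem1p3 (ν : ℕ) (hν : 0 < ν) (q : ℂ) (hq : ‖q‖ < 1) :
    HasSum (fun n : Fin ν → ℕ => hierarchyTerm q ν hν n)
      (qPochInf (-q ^ 3) (q ^ 3) / qPochInf (q ^ 12) (q ^ 12) *
        (qPochInf (q ^ (6 * (ν + 1))) (q ^ (6 * (ν + 1))) *
          qPochInf (-q ^ (3 * ν + 1)) (q ^ (6 * (ν + 1))) *
          qPochInf (-q ^ (3 * ν + 5)) (q ^ (6 * (ν + 1))))) := by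
  -- The triple product divides by s and z, powers of q, so q = 0 is separate: only n = 0
  -- contributes.
  rcases eq_or_ne q 0 with rfl | hq0
  · simp only [hierarchyTerm_base_zero]
    simpa [qPochInf_zero_left] using hasSum_ite_eq (0 : Fin ν → ℕ) (1 : ℂ)
  obtain ⟨m, rfl⟩ := Nat.exists_eq_succ_of_ne_zero hν.ne'
  have h3 : ‖q ^ 3‖ < 1 := norm_pow_lt_one hq (by norm_num)
  have hc := summable_norm_jacobi h3 (pow_ne_zero 3 hq0) (pow_ne_zero 2 hq0)
  have hval := tsum_hierarchyTerm_mul hq hc (baileyBeta_zero hq hq0) m hν (fun _ => 1)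
    (D := 1) (fun _ => by simp)
  simp only [mul_one] at hval
  rw [tsum_baileyBeta h3 hc] at hval
  -- The base q^(3(m+2)) collects one factor s^(j²) from the seed and m + 1 = ν from the chain and
  -- its limit.
  have hjtp := jacobi_triple_product (norm_pow_lt_one hq (k := 3 * (m + 2)) (by omega))
    (pow_ne_zero _ hq0) (pow_ne_zero 2 hq0)
  have e1 : ∀ j : ℤ, (q ^ 3) ^ j.natAbs ^ 2 * (q ^ 2) ^ j * (q ^ 3) ^ ((m + 1) * j.natAbs ^ 2) =
      (q ^ (3 * (m + 2))) ^ j.natAbs ^ 2 * (q ^ 2) ^ j := fun j => by ring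
  simp only [e1] at hval
  have e2 : -(q ^ 2 * q ^ (3 * (m + 2))) = -q ^ (3 * (m + 1) + 5) := by ring
  have e3 : -(q ^ (3 * (m + 2)) / q ^ 2) = -q ^ (3 * (m + 1) + 1) := by
    rw [show 3 * (m + 2) = 3 * (m + 1) + 1 + 2 by ring, pow_add _ _ 2,
      mul_div_cancel_right₀ _ (pow_ne_zero 2 hq0)]
  have e4 : (q ^ (3 * (m + 2))) ^ 2 = q ^ (6 * (m + 1 + 1)) := by ring
  rw [hjtp, e2, e3, e4, show (q ^ 3) ^ 2 = q ^ 6 by ring, qPochInf_prefactor hq,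
    mul_right_comm (qPochInf (q ^ (6 * (m + 1 + 1))) _)] at hval
  rw [← hval]
  exact (summable_norm_hierarchyTerm hq m hν).of_norm.hasSum
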